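/- Let $k$ be a field, let $Q$ be a finite quiver, and let $I$ be an admissible ideal of the path algebra $kQ$; that is, every path occurring (with non-zero coefficient) in an element of $I$ has length at least two, and for some $N>1$ all paths of length $N$ lie in $I$. Let $\Lambda = kQ/I$ be the corresponding bound quiver algebra. Call an arrow $\alpha$ of $Q$ *redundant* if the two-sided ideal $I$ has a generating set $T$ such that no path occurring in an element of $T$ passes through $\alpha$. Let $A$ be a set of redundant arrows, and let $\Gamma = \Lambda/\langle A+I\rangle$ be the quotient of $\Lambda$ by the two-sided ideal generated by the residue classes of the arrows in $A$. For a ring $R$, let $\operatorname{fpd}R$ (respectively $\operatorname{Fpd}R$) denote the supremum of the projective dimensions of the finitely generated (respectively all) left $R$-modules of finite projective dimension, and let $\operatorname{gd}R$ denote the left global dimension of $R$, i.e. the supremum of the projective dimensions of all left $R$-modules; the values $\infty$ are allowed. Then $$\operatorname{fpd}\Lambda = \begin{cases} \operatorname{fpd}\Gamma, & \text{if } \operatorname{fpd}\Gamma > 0,\\ 1, & \text{if } \operatorname{fpd}\Gamma = 0 \text{ and } A \neq \emptyset, \end{cases}$$ and the same holds with $\operatorname{fpd}$ replaced throughout by $\operatorname{Fpd}$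 or by $\operatorname{gd}$. -/

import Mathlib

open CategoryTheory

universe u v w

noncomputable section

/-! ### Path algebras -/

namespace BoundQuiver

/-- The set of all paths of `Q` (including the trivial path at each vertex). -/
structure QPath (Q : Type u) [Quiver.{v} Q] : Type (max u v) where
  source : Q
  target : Q
  path : Quiver.Path source target

/-- The length of a path. -/
def QPath.length {Q : Type u} [Quiver.{v} Q] (p : QPath Q) : ℕ := p.path.length

/-- The trivial path at a vertex. -/
def QPath.trivial {Q : Type u} [Quiver.{v} Q] (a : Q) : QPath Q := ⟨a, a, Quiver.Path.nil⟩

/-- An arrow as a path of length one. -/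
def arrowPath {Q : Type u} [Quiver.{v} Q] (α : Quiver.Total Q) : QPath Q :=
  ⟨α.left, α.right, α.hom.toPath⟩

/-- The concatenation "first `p`, then `q`" of two paths with `target p = source q`. -/
def QPath.comp {Q : Type u} [Quiver.{v} Q] (p q : QPath Q) (h : p.target = q.source) : QPath Q :=
  ⟨p.source, q.target, p.path.comp (q.path.cast h.symm rfl)⟩

/-- The path `p` passes through the arrow `α`: `p = p₁ α p₂` for some paths `p₁`, `p₂`. -/
def QPath.PassesThrough {Q : Type u} [Quiver.{v} Q] (p : QPath Q) (α : Quiver.Total Q) : Prop :=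
  ∃ (p₁ : Quiver.Path p.source α.left) (p₂ : Quiver.Path α.right p.target),
    p.path = (p₁.cons α.hom).comp p₂

/-- The path algebra `k Q`: its `k`-basis is the set of all paths of `Q`. -/
def PathAlgebra (k : Type w) [Field k] (Q : Type u) [Quiver.{v} Q] : Type (max u v w) :=
  QPath Q →₀ k

namespace PathAlgebra

variable {k : Type w} [Field k] {Q : Type u} [Quiver.{v} Q]

instance : AddCommGroup (PathAlgebra k Q) := inferInstanceAs (AddCommGroup (QPath Q →₀ k))

instance : Module k (PathAlgebra k Q) := inferInstanceAs (Module k (QPath Q →₀ k))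

/-- A path, as an element of the path algebra. -/
def ofPath (k : Type w) [Field k] {Q : Type u} [Quiver.{v} Q] (p : QPath Q) : PathAlgebra k Q :=
  Finsupp.single p (1 : k)

/-- The path `p` occurs in `z` if its coefficient in `z` is non-zero. -/
def Occurs (p : QPath Q) (z : PathAlgebra k Q) : Prop :=
  p ∈ Finsupp.support (show QPath Q →₀ k from z)

open Classical in
/-- The product of two paths: their concatenation if they are composable, and zero otherwise. -/
def pathMul (k : Type w) [Field k] {Q : Type u} [Quiver.{v} Q] (p q : QPath Q) :
    PathAlgebra k Q :=
  if h : p.target = q.source then ofPath k (p.comp q h) else 0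

/-- The bilinear extension of the product of paths. -/
def mulLin (k : Type w) [Field k] (Q : Type u) [Quiver.{v} Q] :
    PathAlgebra k Q →ₗ[k] PathAlgebra k Q →ₗ[k] PathAlgebra k Q :=
  Finsupp.linearCombination k fun p : QPath Q =>
    (Finsupp.linearCombination k (pathMul k p) : PathAlgebra k Q →ₗ[k] PathAlgebra k Q)

instance : Mul (PathAlgebra k Q) := ⟨fun x y => mulLin k Q x y⟩

/-- The unit is the sum of all trivial paths. -/
instance [Fintype Q] : One (PathAlgebra k Q) := ⟨∑ a : Q, ofPath k (QPath.trivial a)⟩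

lemma mul_def (x y : PathAlgebra k Q) : x * y = mulLin k Q x y := rfl

lemma one_def [Fintype Q] : (1 : PathAlgebra k Q) = ∑ a : Q, ofPath k (QPath.trivial a) := rfl

lemma induction {P : PathAlgebra k Q → Prop} (x : PathAlgebra k Q) (h0 : P 0)
    (hadd : ∀ x y, P x → P y → P (x + y)) (hp : ∀ (c : k) (p : QPath Q), P (c • ofPath k p)) :
    P x := by
  refine Finsupp.induction_linear (motive := P) x h0 hadd fun p c => ?_
  have := hp c p
  unfold ofPath at this
  have e : (c • (Finsupp.single p (1 : k)) : QPath Q →₀ k) = Finsupp.single p c := by simp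
  exact e ▸ this

lemma ofPath_mul_ofPath (p q : QPath Q) : ofPath k p * ofPath k q = pathMul k p q := by
  rw [mul_def, mulLin, ofPath, ofPath]
  erw [Finsupp.linearCombination_single, one_smul, Finsupp.linearCombination_single, one_smul]

lemma pathMul_of_eq (p q : QPath Q) (h : p.target = q.source) :
    pathMul k p q = ofPath k (p.comp q h) := dif_pos h

lemma pathMul_of_ne (p q : QPath Q) (h : p.target ≠ q.source) :
    pathMul k p q = 0 := dif_neg h

lemma comp_assoc (p q r : QPath Q) (h : p.target = q.source) (h' : q.target = r.source) :
    (p.comp q h).comp r h' = p.comp (q.comp r h') h := by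
  obtain ⟨a, b, p⟩ := p
  obtain ⟨c, d, q⟩ := q
  obtain ⟨e, f, r⟩ := r
  dsimp at h h'
  subst h h'
  simp [QPath.comp]

lemma add_mul' (x y z : PathAlgebra k Q) : (x + y) * z = x * z + y * z := by
  simp [mul_def]

lemma mul_add' (x y z : PathAlgebra k Q) : x * (y + z) = x * y + x * z := by
  simp [mul_def]

lemma zero_mul' (x : PathAlgebra k Q) : 0 * x = 0 := by simp [mul_def]

lemma mul_zero' (x : PathAlgebra k Q) : x * 0 = 0 := by simp [mul_def]

lemma smul_mul' (c : k) (x y : PathAlgebra k Q) : (c • x) * y = c • (x * y) := by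
  simp [mul_def]

lemma mul_smul' (c : k) (x y : PathAlgebra k Q) : x * (c • y) = c • (x * y) := by
  simp [mul_def]

lemma mul_assoc' (x y z : PathAlgebra k Q) : x * y * z = x * (y * z) := by
  induction x using induction with
  | h0 => simp only [zero_mul']
  | hadd x x' h h' => simp only [add_mul', h, h']
  | hp a p =>
  induction y using induction with
  | h0 => simp only [zero_mul', mul_zero']
  | hadd x x' h h' => simp only [add_mul', mul_add', h, h']
  | hp b q =>
  induction z using induction with
  | h0 => simp only [mul_zero']
  | hadd x x' h h' => simp only [mul_add', h, h']
  | hp c r =>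
  simp only [smul_mul', mul_smul', ofPath_mul_ofPath]
  congr 3
  by_cases h : p.target = q.source
  · rw [pathMul_of_eq p q h, ofPath_mul_ofPath]
    by_cases h' : q.target = r.source
    · rw [pathMul_of_eq q r h', ofPath_mul_ofPath, pathMul_of_eq (p.comp q h) r h',
        pathMul_of_eq p (q.comp r h') h, comp_assoc]
    · rw [pathMul_of_ne q r h', pathMul_of_ne (p.comp q h) r h', mul_zero']
  · rw [pathMul_of_ne p q h, zero_mul']
    by_cases h' : q.target = r.source
    · rw [pathMul_of_eq q r h', ofPath_mul_ofPath, pathMul_of_ne p (q.comp r h') h]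
    · rw [pathMul_of_ne q r h', mul_zero']

lemma one_mul' [Fintype Q] (x : PathAlgebra k Q) : 1 * x = x := by
  induction x using induction with
  | h0 => exact mul_zero' _
  | hadd x x' h h' => rw [mul_add', h, h']
  | hp a p =>
  rw [mul_smul', one_def, mul_def, map_sum, LinearMap.sum_apply,
    Finset.sum_eq_single p.source, ← mul_def, ofPath_mul_ofPath, pathMul_of_eq _ _ rfl]
  · congr 2
    obtain ⟨a, b, p⟩ := p
    simp [QPath.comp, QPath.trivial]
  · intro b _ hb
    rw [← mul_def, ofPath_mul_ofPath, pathMul_of_ne]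
    exact hb
  · simp

lemma mul_one' [Fintype Q] (x : PathAlgebra k Q) : x * 1 = x := by
  induction x using induction with
  | h0 => exact zero_mul' _
  | hadd x x' h h' => rw [add_mul', h, h']
  | hp a p =>
  rw [smul_mul', one_def, mul_def, map_sum,
    Finset.sum_eq_single p.target, ← mul_def, ofPath_mul_ofPath, pathMul_of_eq _ _ rfl]
  · congr 2
  · intro b _ hb
    rw [← mul_def, ofPath_mul_ofPath, pathMul_of_ne]
    exact hb.symm
  · simp

instance [Fintype Q] : Ring (PathAlgebra k Q) :=
  { (inferInstance : AddCommGroup (PathAlgebra k Q)) with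
    mul := (· * ·)
    one := 1
    left_distrib := mul_add'
    right_distrib := add_mul'
    zero_mul := zero_mul'
    mul_zero := mul_zero'
    mul_assoc := mul_assoc'
    one_mul := one_mul'
    mul_one := mul_one' }

instance [Fintype Q] : Algebra k (PathAlgebra k Q) :=
  Algebra.ofModule smul_mul' mul_smul'

end PathAlgebra

/-! ### Bound quiver algebras and redundant arrows -/

variable {k : Type w} [Field k] {Q : Type u} [Quiver.{v} Q] [Fintype Q]

open PathAlgebra

/-- Admissible ideals: every path occurring in `I` has length at least two, and for some `N > 1`
all paths of length `N` are contained in `I`. -/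
def IsAdmissible (I : TwoSidedIdeal (PathAlgebra k Q)) : Prop :=
  (∀ z ∈ I, ∀ p : QPath Q, Occurs p z → 2 ≤ p.length) ∧
    ∃ N : ℕ, 1 < N ∧ ∀ p : QPath Q, p.length = N → ofPath k p ∈ I

/-- The arrow `α` is redundant for `k Q / I`: some generating set `T` of the ideal `I` avoids `α`,
that is, no path occurring in an element of `T` passes through `α`. -/
def IsRedundant (I : TwoSidedIdeal (PathAlgebra k Q)) (α : Quiver.Total Q) : Prop :=
  ∃ T : Set (PathAlgebra k Q), TwoSidedIdeal.span T = I ∧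
    ∀ z ∈ T, ∀ p : QPath Q, Occurs p z → ¬ p.PassesThrough α

/-- The quotient algebra `Λ = k Q / I`. -/
abbrev QuiverAlg (I : TwoSidedIdeal (PathAlgebra k Q)) : Type (max u v w) := I.ringCon.Quotient

/-- The ideal of `Λ = k Q / I` generated by the residue classes of the arrows in `A`. -/
def arrowIdeal (I : TwoSidedIdeal (PathAlgebra k Q)) (A : Set (Quiver.Total Q)) :
    TwoSidedIdeal (QuiverAlg I) :=
  TwoSidedIdeal.span ((fun α : Quiver.Total Q => I.ringCon.mk' (ofPath k (arrowPath α))) '' A)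

/-- The quotient of `Λ = k Q / I` by the ideal generated by the arrows in `A`. -/
abbrev ArrowQuot (I : TwoSidedIdeal (PathAlgebra k Q)) (A : Set (Quiver.Total Q)) :
    Type (max u v w) :=
  (arrowIdeal I A).ringCon.Quotient

end BoundQuiver

/-! ### Homological dimensions of a ring

The projective dimension of the zero module is `⊥`, which does not affect any of the
suprema below when the ring is non-zero. -/

/-- The little finitistic dimension: the supremum of the projective dimensions of the finitely
generated left modules of finite projective dimension. -/
def littleFinitisticDim (R : Type u) [Ring R] : WithBot ℕ∞ :=
  ⨆ M : {M : ModuleCat.{u} R // Module.Finite R M ∧ projectiveDimension M ≠ ⊤},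
    projectiveDimension M.1

/-- The big finitistic dimension: the supremum of the projective dimensions of the left modules
of finite projective dimension. -/
def bigFinitisticDim (R : Type u) [Ring R] : WithBot ℕ∞ :=
  ⨆ M : {M : ModuleCat.{u} R // projectiveDimension M ≠ ⊤}, projectiveDimension M.1

/-- The (left) global dimension: the supremum of the projective dimensions of all left modules. -/
def globalDim (R : Type u) [Ring R] : WithBot ℕ∞ :=
  ⨆ M : ModuleCat.{u} R, projectiveDimension M

end

-- Write `Γ` for the quotient of `Λ` by the arrows in `A`. Since redundant arrows occur in no
-- relation of a suitable generating set of `I`, the algebra `Λ` is obtained from `Γ` by freely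
-- adjoining those arrows. There is a section `σ : Γ → Λ` of the projection `π`, and a `Γ`-module
-- becomes a `Λ`-module by letting each `α ∈ A` act through an arbitrary `k`-linear map from its `f
-- α`-part to its `e α`-part. `IsFreeExtension` records this, and all the homological algebra uses
-- nothing else about adjoining arrows.
--
-- The freedom is used to put `Λ`-structures on covers and extensions, which then split over
-- projectives. Restriction along `σ` preserves projectives (`projective_restrict`), so it does not
-- raise projective dimension. A `Λ`-submodule of a projective is projective as soon as it is so
-- over `Γ` (`projective_of_injective`). Hence the projective dimension over `Λ` is at most the
-- maximum of 1 and that over `Γ`.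
--
-- Inflation along `π` followed by restriction along `σ` is the identity, so every projective
-- dimension over `Γ` bounds one over `Λ` from below. Finally, `Γ` with the adjoined arrows acting
-- as zero is not projective over `Λ` (`eq_zero_of_projective`), so it has dimension exactly 1.
-- Taking suprema gives all three statements.

universe x

/-! ### Homomorphisms out of the path algebra -/

namespace BoundQuiver
namespace PathAlgebra

variable {k : Type w} [Field k] {Q : Type u} [Quiver.{v} Q]

/-- The coefficient of a path. -/
noncomputable def coeff (k : Type w) [Field k] {Q : Type u} [Quiver.{v} Q] (p : QPath Q) :
    PathAlgebra k Q →ₗ[k] k :=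
  Finsupp.lapply p

lemma occurs_iff (p : QPath Q) (z : PathAlgebra k Q) : Occurs p z ↔ coeff k p z ≠ 0 :=
  Finsupp.mem_support_iff

open Classical in
lemma coeff_ofPath (p q : QPath Q) : coeff k p (ofPath k q) = if q = p then 1 else 0 :=
  Finsupp.single_apply

lemma ofPath_mul_ofPath_comp {a b c : Q} (p : Quiver.Path a b) (q : Quiver.Path b c) :
    ofPath k ⟨a, b, p⟩ * ofPath k ⟨b, c, q⟩ = ofPath k ⟨a, c, p.comp q⟩ := by
  rw [ofPath_mul_ofPath, pathMul_of_eq _ _ rfl]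
  rfl

lemma ofPath_cons {a b c : Q} (p : Quiver.Path a b) (f : b ⟶ c) :
    ofPath k ⟨a, c, p.cons f⟩ = ofPath k ⟨a, b, p⟩ * ofPath k (arrowPath ⟨b, c, f⟩) :=
  (ofPath_mul_ofPath_comp p f.toPath).symm

lemma ofPath_mul_ofPath_of_ne (p q : QPath Q) (h : p.target ≠ q.source) :
    ofPath k p * ofPath k q = 0 := by
  rw [ofPath_mul_ofPath, pathMul_of_ne _ _ h]

lemma trivial_mul_self (a : Q) :
    ofPath k (QPath.trivial a) * ofPath k (QPath.trivial a) = ofPath k (QPath.trivial a) :=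
  ofPath_mul_ofPath_comp Quiver.Path.nil Quiver.Path.nil

lemma trivial_mul_trivial_of_ne {a b : Q} (h : a ≠ b) :
    ofPath k (QPath.trivial a) * ofPath k (QPath.trivial b) = 0 :=
  ofPath_mul_ofPath_of_ne _ _ h

lemma trivial_mul_arrow (α : Quiver.Total Q) :
    ofPath k (QPath.trivial α.left) * ofPath k (arrowPath α) = ofPath k (arrowPath α) := by
  refine (ofPath_mul_ofPath_comp Quiver.Path.nil α.hom.toPath).trans ?_
  rw [Quiver.Path.nil_comp]; rfl

lemma arrow_mul_trivial (α : Quiver.Total Q) :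
    ofPath k (arrowPath α) * ofPath k (QPath.trivial α.right) = ofPath k (arrowPath α) :=
  ofPath_mul_ofPath_comp α.hom.toPath Quiver.Path.nil

lemma not_passesThrough_nil (a : Q) (α : Quiver.Total Q) :
    ¬ (⟨a, a, Quiver.Path.nil⟩ : QPath Q).PassesThrough α := by
  rintro ⟨p₁, p₂, h⟩
  have := congrArg Quiver.Path.length h
  simp only [Quiver.Path.length_nil, Quiver.Path.length_comp, Quiver.Path.length_cons] at this
  omega

lemma passesThrough_cons_of_passesThrough {a b c : Q} {p : Quiver.Path a b} (f : b ⟶ c)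
    {α : Quiver.Total Q} (h : (⟨a, b, p⟩ : QPath Q).PassesThrough α) :
    (⟨a, c, p.cons f⟩ : QPath Q).PassesThrough α := by
  obtain ⟨p₁, p₂, h⟩ := h
  dsimp only at p₁ p₂ h
  exact ⟨p₁, p₂.cons f, by simp [h]⟩

lemma passesThrough_cons_self {a b c : Q} (p : Quiver.Path a b) (f : b ⟶ c) :
    (⟨a, c, p.cons f⟩ : QPath Q).PassesThrough ⟨b, c, f⟩ :=
  ⟨p, Quiver.Path.nil, rfl⟩

section Lift

variable {S : Type x} [Ring S] [Algebra k S]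

/-- The product in `S` of the elements assigned to the arrows of a path, starting with the
element assigned to the source. -/
def pathEval (E : Q → S) (F : Quiver.Total Q → S) {a : Q} : ∀ {b : Q}, Quiver.Path a b → S
  | _, .nil => E a
  | _, .cons (b := b) (c := c) p f => pathEval E F p * F ⟨b, c, f⟩

variable {E : Q → S} {F : Quiver.Total Q → S}

lemma pathEval_mul_target (hE : ∀ a, E a * E a = E a) (hr : ∀ α, F α * E α.right = F α)
    {a b : Q} (p : Quiver.Path a b) : pathEval E F p * E b = pathEval E F p := by
  cases p with
  | nil => exact hE a
  | cons p f => rw [pathEval, mul_assoc, hr]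

lemma source_mul_pathEval (hE : ∀ a, E a * E a = E a)
    {a b : Q} (p : Quiver.Path a b) : E a * pathEval E F p = pathEval E F p := by
  induction p with
  | nil => exact hE a
  | cons p f ih => rw [pathEval, ← mul_assoc, ih]

lemma pathEval_comp (hE : ∀ a, E a * E a = E a) (hr : ∀ α, F α * E α.right = F α)
    {a b c : Q} (p : Quiver.Path a b) (q : Quiver.Path b c) :
    pathEval E F (p.comp q) = pathEval E F p * pathEval E F q := by
  induction q with
  | nil => exact (pathEval_mul_target hE hr p).symm
  | cons q f ih => rw [Quiver.Path.comp_cons, pathEval, ih, pathEval, mul_assoc]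

/-- The linear map from the path algebra which evaluates paths in `S`. -/
noncomputable def liftLin (k : Type w) [Field k] [Algebra k S] (E : Q → S) (F : Quiver.Total Q → S) :
    PathAlgebra k Q →ₗ[k] S :=
  Finsupp.linearCombination k fun p : QPath Q => pathEval E F p.path

lemma liftLin_ofPath (p : QPath Q) : liftLin k E F (ofPath k p) = pathEval E F p.path := by
  rw [liftLin, ofPath]
  erw [Finsupp.linearCombination_single, one_smul]

variable [Fintype Q]

/-- The homomorphism from the path algebra determined by its values on vertices and arrows. -/
noncomputable def lift (hE : ∀ a, E a * E a = E a) (hne : ∀ a b, a ≠ b → E a * E b = 0) (h1 : ∑ a, E a = 1)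
    (hr : ∀ α, F α * E α.right = F α) : PathAlgebra k Q →ₐ[k] S :=
  AlgHom.ofLinearMap (liftLin k E F)
    (by
      rw [one_def, map_sum, ← h1]
      exact Finset.sum_congr rfl fun a _ => liftLin_ofPath _)
    (by
      intro y z
      induction y using induction with
      | h0 => simp
      | hadd y y' h h' => simp only [add_mul, map_add, h, h']
      | hp c p =>
      induction z using induction with
      | h0 => simp
      | hadd z z' h h' => simp only [mul_add, map_add, h, h']
      | hp d q =>
      simp only [smul_mul_assoc, mul_smul_comm, map_smul, liftLin_ofPath]
      congr 2
      obtain ⟨a, b, p⟩ := p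
      obtain ⟨c, d, q⟩ := q
      by_cases h : b = c
      · subst h
        rw [ofPath_mul_ofPath_comp, liftLin_ofPath, pathEval_comp hE hr]
      · rw [ofPath_mul_ofPath_of_ne _ _ h, map_zero, ← pathEval_mul_target hE hr p,
          ← source_mul_pathEval hE q, mul_assoc, ← mul_assoc (E b), hne _ _ h, zero_mul, mul_zero])

lemma lift_ofPath (hE : ∀ a, E a * E a = E a) (hne : ∀ a b, a ≠ b → E a * E b = 0)
    (h1 : ∑ a, E a = 1) (hr : ∀ α, F α * E α.right = F α) (p : QPath Q) :
    lift (k := k) hE hne h1 hr (ofPath k p) = pathEval E F p.path :=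
  liftLin_ofPath p

lemma algHom_eq_on_avoiding {A : Set (Quiver.Total Q)} {Φ Ψ : PathAlgebra k Q →ₐ[k] S}
    (hv : ∀ a, Φ (ofPath k (QPath.trivial a)) = Ψ (ofPath k (QPath.trivial a)))
    (ha : ∀ α ∉ A, Φ (ofPath k (arrowPath α)) = Ψ (ofPath k (arrowPath α)))
    (p : QPath Q) (hp : ∀ α ∈ A, ¬ p.PassesThrough α) : Φ (ofPath k p) = Ψ (ofPath k p) := by
  obtain ⟨a, b, p⟩ := p
  induction p with
  | nil => exact hv a
  | cons p f ih =>
    rw [ofPath_cons, map_mul, map_mul, ha _ fun h => hp _ h (passesThrough_cons_self p f),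
      ih fun α h h' => hp α h (passesThrough_cons_of_passesThrough f h')]

lemma algHom_eq_of_avoiding {A : Set (Quiver.Total Q)} {Φ Ψ : PathAlgebra k Q →ₐ[k] S}
    (hv : ∀ a, Φ (ofPath k (QPath.trivial a)) = Ψ (ofPath k (QPath.trivial a)))
    (ha : ∀ α ∉ A, Φ (ofPath k (arrowPath α)) = Ψ (ofPath k (arrowPath α)))
    (z : PathAlgebra k Q) (hz : ∀ p, Occurs p z → ∀ α ∈ A, ¬ p.PassesThrough α) :
    Φ z = Ψ z := by
  have e : z = ∑ p ∈ Finsupp.support (show QPath Q →₀ k from z),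
      (show QPath Q →₀ k from z) p • ofPath k p := by
    have := Finsupp.sum_single (show QPath Q →₀ k from z)
    refine this.symm.trans (Finset.sum_congr rfl fun p _ => ?_)
    exact (by simp : Finsupp.single p ((show QPath Q →₀ k from z) p) =
      ((show QPath Q →₀ k from z) p) • (Finsupp.single p (1 : k) : QPath Q →₀ k))
  rw [e, map_sum, map_sum]
  refine Finset.sum_congr rfl fun p hp => ?_
  rw [map_smul, map_smul, algHom_eq_on_avoiding hv ha p (hz p hp)]

lemma algHom_ext {Φ Ψ : PathAlgebra k Q →ₐ[k] S}
    (hv : ∀ a, Φ (ofPath k (QPath.trivial a)) = Ψ (ofPath k (QPath.trivial a)))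
    (ha : ∀ α, Φ (ofPath k (arrowPath α)) = Ψ (ofPath k (arrowPath α))) : Φ = Ψ :=
  AlgHom.ext fun z => algHom_eq_of_avoiding (A := ∅) hv (fun α _ => ha α) z (by simp)

/-- The values of a homomorphism on a set of arrows can be changed freely. -/
lemma exists_algHom_update (Ψ : PathAlgebra k Q →ₐ[k] S) (A : Set (Quiver.Total Q))
    (c : A → S)
    (hc : ∀ α : A, Ψ (ofPath k (QPath.trivial α.1.left)) * c α *
      Ψ (ofPath k (QPath.trivial α.1.right)) = c α) :
    ∃ Φ : PathAlgebra k Q →ₐ[k] S,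
      (∀ p : QPath Q, (∃ α ∈ A, c = 0 ∧ p.PassesThrough α) → Φ (ofPath k p) = 0) ∧
      (∀ a, Φ (ofPath k (QPath.trivial a)) = Ψ (ofPath k (QPath.trivial a))) ∧
      (∀ α ∉ A, Φ (ofPath k (arrowPath α)) = Ψ (ofPath k (arrowPath α))) ∧
      ∀ α : A, Φ (ofPath k (arrowPath α.1)) = c α := by
  classical
  set E : Q → S := fun a => Ψ (ofPath k (QPath.trivial a)) with hEdef
  set F : Quiver.Total Q → S := fun α =>
    if h : α ∈ A then c ⟨α, h⟩ else Ψ (ofPath k (arrowPath α)) with hF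
  have hE : ∀ a, E a * E a = E a := fun a => by
    rw [hEdef]; dsimp only; rw [← map_mul, trivial_mul_self]
  have hne : ∀ a b, a ≠ b → E a * E b = 0 := fun a b h => by
    rw [hEdef]; dsimp only; rw [← map_mul, trivial_mul_trivial_of_ne h, map_zero]
  have h1 : ∑ a, E a = 1 := by
    rw [hEdef, ← map_sum, ← one_def, map_one]
  have hFA : ∀ α : A, F α = c α := fun α => by simp [hF]
  have hFn : ∀ α ∉ A, F α = Ψ (ofPath k (arrowPath α)) := fun α h => by simp [hF, h]
  have hr : ∀ α, F α * E α.right = F α := by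
    intro α
    by_cases h : α ∈ A
    · have h2 := hFA ⟨α, h⟩
      have := hc ⟨α, h⟩
      rw [show F α = c ⟨α, h⟩ from h2, ← this, mul_assoc, hE]
    · rw [hFn α h, hEdef]
      dsimp only
      rw [← map_mul, arrow_mul_trivial]
  -- An arrow evaluates to `E α.left * F α`, because path evaluation starts at the source
  -- idempotent. This relation reduces that value to `F α`.
  have hl : ∀ α, E α.left * F α = F α := by
    intro α
    by_cases h : α ∈ A
    · have h2 := hFA ⟨α, h⟩
      have := hc ⟨α, h⟩
      rw [show F α = c ⟨α, h⟩ from h2, ← this, ← mul_assoc, ← mul_assoc, hE]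
    · rw [hFn α h, hEdef]
      dsimp only
      rw [← map_mul, trivial_mul_arrow]
  have harr : ∀ α, lift (k := k) hE hne h1 hr (ofPath k (arrowPath α)) = F α := fun α => by
    rw [lift_ofPath]
    exact hl α
  refine ⟨lift hE hne h1 hr, ?_, fun a => lift_ofPath hE hne h1 hr _,
    fun α h => (harr α).trans (hFn α h), fun α => (harr α).trans (hFA α)⟩
  rintro p ⟨α, hα, rfl, p₁, p₂, h⟩
  rw [lift_ofPath, h, pathEval_comp hE hr, pathEval]
  have := hFA ⟨α, hα⟩
  simp only [Pi.zero_apply] at this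
  rw [show F ⟨α.left, α.right, α.hom⟩ = 0 from this, mul_zero, zero_mul]

end Lift

/-! ### Killing one arrow, and generating sets that avoid several redundant arrows -/

section Kill

variable [Fintype Q]

/-- The endomorphism of the path algebra which kills the arrow `α`. -/
lemma exists_killArrow (k : Type w) [Field k] (α : Quiver.Total Q) :
    ∃ ρ : PathAlgebra k Q →ₐ[k] PathAlgebra k Q,
      (∀ p : QPath Q, p.PassesThrough α → ρ (ofPath k p) = 0) ∧
      (∀ p : QPath Q, ¬ p.PassesThrough α → ρ (ofPath k p) = ofPath k p) := by
  obtain ⟨ρ, h0, hv, ha, -⟩ := exists_algHom_update (AlgHom.id k (PathAlgebra k Q)) {α} 0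
    (by simp)
  exact ⟨ρ, fun p hp => h0 p ⟨α, rfl, rfl, hp⟩,
    fun p hp => algHom_eq_on_avoiding (A := {α}) (Ψ := AlgHom.id k _) hv ha p (by simpa using hp)⟩

lemma occurs_of_killArrow {α : Quiver.Total Q} {ρ : PathAlgebra k Q →ₐ[k] PathAlgebra k Q}
    (h0 : ∀ p : QPath Q, p.PassesThrough α → ρ (ofPath k p) = 0)
    (h1 : ∀ p : QPath Q, ¬ p.PassesThrough α → ρ (ofPath k p) = ofPath k p)
    (z : PathAlgebra k Q) (p : QPath Q) (hp : Occurs p (ρ z)) :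
    Occurs p z ∧ ¬ p.PassesThrough α := by
  classical
  have key : coeff k p (ρ z) = if p.PassesThrough α then 0 else coeff k p z := by
    clear hp
    induction z using induction with
    | h0 => simp
    | hadd y z hy hz =>
      rw [map_add, map_add, hy, hz, map_add]
      split_ifs <;> simp
    | hp c q =>
      rw [map_smul, map_smul, map_smul]
      by_cases hq : q.PassesThrough α
      · rw [h0 q hq, map_zero, smul_zero]
        split_ifs with hp
        · rfl
        · rw [coeff_ofPath, if_neg (by rintro rfl; exact hp hq), smul_zero]
      · rw [h1 q hq]
        split_ifs with hp
        · rw [coeff_ofPath, if_neg (by rintro rfl; exact hq hp), smul_zero]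
        · rfl
  rw [occurs_iff, key] at hp
  rw [occurs_iff]
  split_ifs at hp with h
  · exact absurd rfl hp
  · exact ⟨hp, h⟩

end Kill

end PathAlgebra

open PathAlgebra

variable {k : Type w} [Field k] {Q : Type u} [Quiver.{v} Q] [Fintype Q]

/-- Finitely many redundant arrows can be avoided by one and the same generating set. -/
lemma exists_generators_avoiding {I : TwoSidedIdeal (PathAlgebra k Q)} {A : Set (Quiver.Total Q)}
    (hfin : A.Finite) (hA : ∀ α ∈ A, IsRedundant I α) :
    ∃ T : Set (PathAlgebra k Q), TwoSidedIdeal.span T = I ∧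
      ∀ z ∈ T, ∀ p : QPath Q, Occurs p z → ∀ α ∈ A, ¬ p.PassesThrough α := by
  induction A, hfin using Set.Finite.induction_on with
  | empty =>
    exact ⟨I, le_antisymm (TwoSidedIdeal.span_le.2 fun _ h => h) TwoSidedIdeal.subset_span,
      by simp⟩
  | @insert α B _ _ ih =>
    obtain ⟨T, hT, hTB⟩ := ih fun β hβ => hA β (Set.mem_insert_of_mem _ hβ)
    obtain ⟨T', hT', hTα⟩ := hA α (Set.mem_insert _ _)
    obtain ⟨ρ, h0, h1⟩ := exists_killArrow k α
    -- The generators in `T'` avoid `α`, so killing `α` leaves them unchanged. Consequently `ρ` maps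
    -- `I` into itself, and the image of any generating set still generates `T'`, hence `I`. So `ρ
    -- '' T` generates `I`. It avoids `α`, and still avoids `B` since `ρ` only deletes terms.
    have hfix : ∀ z ∈ T', ρ z = z := fun z hz =>
      algHom_eq_of_avoiding (A := {α}) (Φ := ρ) (Ψ := AlgHom.id k _)
        (fun a => h1 _ (not_passesThrough_nil a α))
        (fun β hβ => h1 _ (by
          rintro ⟨p₁, p₂, h⟩
          obtain ⟨a, b, f⟩ := β
          obtain ⟨a', b', f'⟩ := α
          simp only [arrowPath] at p₁ p₂ h
          have hl := congrArg Quiver.Path.length h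
          rw [Quiver.Path.length_toPath, Quiver.Path.length_comp,
            Quiver.Path.length_cons] at hl
          have e1 := Quiver.Path.eq_of_length_zero p₁ (by omega)
          have e2 := Quiver.Path.eq_of_length_zero p₂ (by omega)
          subst e1 e2
          rw [Quiver.Path.eq_nil_of_length_zero p₁ (by omega),
            Quiver.Path.eq_nil_of_length_zero p₂ (by omega)] at h
          simp only [Quiver.Hom.toPath, Quiver.Path.comp_nil,
            Quiver.Path.cons.injEq, heq_eq_eq, true_and] at h
          exact hβ (by simp [h])))
        z (by simpa using hTα z hz)
    have hρI : ∀ z ∈ I, ρ z ∈ I := by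
      have : I ≤ I.comap ρ := by
        conv_lhs => rw [← hT']
        rw [TwoSidedIdeal.span_le]
        intro z hz
        change z ∈ I.comap ρ
        rw [TwoSidedIdeal.mem_comap, hfix z hz, ← hT']
        exact TwoSidedIdeal.subset_span hz
      exact fun z hz => (TwoSidedIdeal.mem_comap _).1 (this hz)
    refine ⟨ρ '' T, le_antisymm ?_ ?_, ?_⟩
    · rw [TwoSidedIdeal.span_le]
      rintro _ ⟨z, hz, rfl⟩
      exact hρI z (by rw [← hT]; exact TwoSidedIdeal.subset_span hz)
    · have hle : I ≤ (TwoSidedIdeal.span (ρ '' T)).comap ρ := by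
        conv_lhs => rw [← hT]
        rw [TwoSidedIdeal.span_le]
        intro z hz
        exact (TwoSidedIdeal.mem_comap _).2 (TwoSidedIdeal.subset_span ⟨z, hz, rfl⟩)
      conv_lhs => rw [← hT']
      rw [TwoSidedIdeal.span_le]
      intro z hz
      have : z ∈ I := by rw [← hT']; exact TwoSidedIdeal.subset_span hz
      have := (TwoSidedIdeal.mem_comap _).1 (hle this)
      rwa [hfix z hz] at this
    · rintro _ ⟨z, hz, rfl⟩ p hp β hβ
      obtain ⟨hpz, hpα⟩ := occurs_of_killArrow h0 h1 z p hp
      rcases Set.mem_insert_iff.1 hβ with rfl | hβ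
      · exact hpα
      · exact hTB z hz p hpz β hβ

instance finite_total [∀ a b : Q, Finite (a ⟶ b)] : Finite (Quiver.Total Q) :=
  Finite.of_injective (β := Σ a b : Q, a ⟶ b) (fun α => ⟨α.left, α.right, α.hom⟩) (by
    rintro ⟨a, b, f⟩ ⟨a', b', f'⟩ h
    cases h
    rfl)

/-- Homomorphisms which agree away from redundant arrows kill `I` simultaneously. -/
lemma algHom_eq_zero_of_redundant {S : Type x} [Ring S] [Algebra k S]
    {I : TwoSidedIdeal (PathAlgebra k Q)} {A : Set (Quiver.Total Q)}
    (hfin : A.Finite) (hA : ∀ α ∈ A, IsRedundant I α) {Φ Ψ : PathAlgebra k Q →ₐ[k] S}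
    (hv : ∀ a, Φ (ofPath k (QPath.trivial a)) = Ψ (ofPath k (QPath.trivial a)))
    (ha : ∀ α ∉ A, Φ (ofPath k (arrowPath α)) = Ψ (ofPath k (arrowPath α)))
    (hΨ : ∀ z ∈ I, Ψ z = 0) : ∀ z ∈ I, Φ z = 0 := by
  obtain ⟨T, rfl, hT⟩ := exists_generators_avoiding hfin hA
  have : TwoSidedIdeal.span T ≤ TwoSidedIdeal.ker Φ := by
    rw [TwoSidedIdeal.span_le]
    intro z hz
    refine (TwoSidedIdeal.mem_ker _).2 ?_
    rw [algHom_eq_of_avoiding hv ha z (hT z hz)]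
    exact hΨ z (TwoSidedIdeal.subset_span hz)
  exact fun z hz => (TwoSidedIdeal.mem_ker _).1 (this hz)

end BoundQuiver

/-! ### Projective modules over a free extension -/

/-- The `k`-algebra `Λ` is obtained from `Γ` by freely adjoining elements `a i` with
`e i * a i * f i = a i`, as far as modules in a universe are concerned. -/
structure IsFreeExtension {k : Type w} {Λ Γ : Type x} [Field k] [Ring Λ] [Ring Γ] [Algebra k Λ]
    [Algebra k Γ] (σ : Γ →ₐ[k] Λ) {ι : Type v} (e f : ι → Γ) (a : ι → Λ) : Prop where
  mul_self_left : ∀ i, e i * e i = e i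
  mul_self_right : ∀ i, f i * f i = f i
  mul_mul : ∀ i, σ (e i) * a i * σ (f i) = a i
  adjoin : Algebra.adjoin k (Set.range σ ∪ Set.range a) = ⊤
  exists_action : ∀ (V : Type x) [AddCommGroup V] [Module k V] [Module Γ V] [IsScalarTower k Γ V]
    (c : ι → Module.End k V), (∀ i y, e i • c i (f i • y) = c i y) →
    ∃ Φ : Λ →ₐ[k] Module.End k V, (∀ γ y, Φ (σ γ) y = γ • y) ∧ ∀ i, Φ (a i) = c i

namespace IsFreeExtension

variable {k : Type w} {Λ Γ : Type x} [Field k] [Ring Λ] [Ring Γ] [Algebra k Λ]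
  [Algebra k Γ] {σ : Γ →ₐ[k] Λ} {ι : Type v} {e f : ι → Γ} {a : ι → Λ}

/-- The image of `σ` and the adjoined elements generate `Λ`. Additivity of `g` is enough because
scalars of `k` already lie in the image of `σ`. -/
lemma map_smul_of_map_smul (H : IsFreeExtension σ e f a) {V W : Type*} [AddCommGroup V]
    [Module Λ V] [AddCommGroup W] [Module Λ W] (g : V →+ W)
    (hσ : ∀ γ y, g (σ γ • y) = σ γ • g y) (ha : ∀ i y, g (a i • y) = a i • g y)
    (l : Λ) (y : V) : g (l • y) = l • g y := by
  have hl : l ∈ Algebra.adjoin k (Set.range σ ∪ Set.range a) := by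
    rw [H.adjoin]; trivial
  induction hl using Algebra.adjoin_induction generalizing y with
  | mem l hl =>
    rcases hl with ⟨γ, rfl⟩ | ⟨i, rfl⟩
    · exact hσ γ y
    · exact ha i y
  | algebraMap r =>
    have := hσ (algebraMap k Γ r) y
    rwa [AlgHom.commutes] at this
  | add l m _ _ hl hm => rw [add_smul, map_add, hl, hm, add_smul]
  | mul l m _ _ hl hm => rw [mul_smul, hl, hm, mul_smul]

lemma smul_smul_smul (H : IsFreeExtension σ e f a) {P : Type*} [AddCommGroup P]
    [Module Γ P] [Module Λ P] (hσ : ∀ (γ : Γ) (y : P), σ γ • y = γ • y) (i : ι) (y : P) : e i • a i • f i • y = a i • y := by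
  rw [← hσ, ← hσ (f i), smul_smul, smul_smul, H.mul_mul]

section

variable {P K : Type x} [AddCommGroup P] [Module k P] [Module Γ P] [Module Λ P]
  [IsScalarTower k Γ P] [AddCommGroup K] [Module k K] [Module Γ K] [Module Λ K]
  [IsScalarTower k Γ K]

lemma isScalarTower (hσ : ∀ (γ : Γ) (y : P), σ γ • y = γ • y) : IsScalarTower k Λ P :=
  IsScalarTower.of_algebraMap_smul fun r y => by
    rw [← σ.commutes r, hσ, algebraMap_smul]

/-- A free `Γ`-cover of `P` can be given a `Λ`-structure that makes the cover `Λ`-linear. It then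
splits over `Λ`, hence over `Γ`. -/
theorem projective_restrict (H : IsFreeExtension σ e f a)
    (hσ : ∀ (γ : Γ) (y : P), σ γ • y = γ • y) [Module.Projective Λ P] :
    Module.Projective Γ P := by
  have := isScalarTower (k := k) hσ
  refine Module.Projective.of_lifting_property'' fun q hq => ?_
  let qk : (P →₀ Γ) →ₗ[k] P := q.restrictScalars k
  obtain ⟨r, hr⟩ := qk.exists_rightInverse_of_surjective (LinearMap.range_eq_top.2 hq)
  replace hr : ∀ y, q (r y) = y := fun y => LinearMap.congr_fun hr y
  -- The action of `a i` on `P` is lifted through the `k`-linear section `r`. The factors `e i` and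
  -- `f i` make the lift satisfy the compatibility required of an action.
  let c : ι → Module.End k (P →₀ Γ) := fun i =>
    Module.toModuleEnd k (S := Γ) (P →₀ Γ) (e i) ∘ₗ r ∘ₗ Module.toModuleEnd k (S := Λ) P (a i) ∘ₗ
      qk ∘ₗ Module.toModuleEnd k (S := Γ) (P →₀ Γ) (f i)
  have hc : ∀ i y, c i y = e i • r (a i • q (f i • y)) := fun i y => rfl
  obtain ⟨Φ, hΦ, hΦa⟩ := H.exists_action (P →₀ Γ) c fun i y => by
    rw [hc, hc, smul_smul, smul_smul, H.mul_self_left, H.mul_self_right]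
  let _ : Module Λ (P →₀ Γ) := Module.compHom _ Φ.toRingHom
  have hs : ∀ (l : Λ) (y : P →₀ Γ), l • y = Φ l y := fun l y => rfl
  have hq' := H.map_smul_of_map_smul (q : (P →₀ Γ) →+ P)
    (fun γ y => by
      rw [hs, hΦ, hσ]
      exact q.map_smul γ y)
    (fun i y => by
      rw [hs, hΦa, hc]
      change q _ = a i • q y
      rw [map_smul, hr, map_smul, H.smul_smul_smul hσ])
  let ql : (P →₀ Γ) →ₗ[Λ] P := { q with map_smul' := hq' }
  obtain ⟨h, hh⟩ := Module.projective_lifting_property ql LinearMap.id hq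
  refine ⟨{ h with map_smul' := fun γ y => ?_ }, LinearMap.ext fun y => LinearMap.congr_fun hh y⟩
  change h (γ • y) = γ • h y
  rw [← hσ, map_smul, hs, hΦ]

/-- A free `Λ`-cover `q` of `K` splits over `Γ` by some `s`. The failure of `s` to commute with the
`a i` extends to `P`, where it defines an extension of `P` by the free module. Projectivity of `P`
splits the extension and yields a correction of `s`. -/
theorem projective_of_injective (H : IsFreeExtension σ e f a)
    (hσ : ∀ (γ : Γ) (y : P), σ γ • y = γ • y) (hσK : ∀ (γ : Γ) (y : K), σ γ • y = γ • y)
    [Module.Projective Λ P] [Module.Projective Γ K] (g : K →ₗ[Λ] P) (hg : Function.Injective g) :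
    Module.Projective Λ K := by
  have := isScalarTower (k := k) hσ
  have := isScalarTower (k := k) hσK
  let _ : Module Γ Λ := Module.compHom Λ (σ : Γ →+* Λ)
  have hσΛ : ∀ (γ : Γ) (l : Λ), γ • l = σ γ • l := fun _ _ => rfl
  have : IsScalarTower k Γ Λ := IsScalarTower.of_algebraMap_smul fun r y => by
    rw [hσΛ, σ.commutes, algebraMap_smul]
  refine Module.Projective.of_lifting_property'' fun q hq => ?_
  have hσE : ∀ (γ : Γ) (y : K →₀ Λ), σ γ • y = γ • y := fun γ y => by
    ext j
    simp [hσΛ]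
  let qΓ : (K →₀ Λ) →ₗ[Γ] K := { q with
    map_smul' := fun γ y => by
      change q (γ • y) = γ • q y
      rw [← hσE, map_smul, hσK] }
  obtain ⟨s, hs⟩ := Module.projective_lifting_property qΓ LinearMap.id hq
  replace hs : ∀ y, q (s y) = y := fun y => LinearMap.congr_fun hs y
  obtain ⟨j, hj⟩ := (g.restrictScalars k).exists_leftInverse_of_injective
    (LinearMap.ker_eq_bot.2 hg)
  replace hj : ∀ y, j (g y) = y := fun y => LinearMap.congr_fun hj y
  let d : ι → K →ₗ[k] (K →₀ Λ) := fun i =>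
    Module.toModuleEnd k (S := Λ) (K →₀ Λ) (a i) ∘ₗ s.restrictScalars k -
      s.restrictScalars k ∘ₗ Module.toModuleEnd k (S := Λ) K (a i)
  have hd : ∀ i y, d i y = a i • s y - s (a i • y) := fun i y => rfl
  -- The defect `d i` lives on `K`. It is carried to `P` by the merely `k`-linear retraction `j`. It
  -- restricts to `d i` along `g` since `g` and `s` are `Γ`-linear and `e i • a i • f i = a i`.
  let δ : ι → P →ₗ[k] (K →₀ Λ) := fun i =>
    Module.toModuleEnd k (S := Γ) (K →₀ Λ) (e i) ∘ₗ d i ∘ₗ j ∘ₗ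
      Module.toModuleEnd k (S := Γ) P (f i)
  have hδ : ∀ i y, δ i y = e i • d i (j (f i • y)) := fun i y => rfl
  have hqd : ∀ i y, q (d i y) = 0 := fun i y => by rw [hd, map_sub, map_smul, hs, hs, sub_self]
  have hqδ : ∀ i y, q (δ i y) = 0 := fun i y => by
    rw [hδ, ← hσE, map_smul, hqd, smul_zero]
  have hδg : ∀ i y, δ i (g y) = d i y := fun i y => by
    rw [hδ, ← hσ, ← g.map_smul, hj, hσK, hd, hd, smul_sub, s.map_smul, H.smul_smul_smul hσE,
      ← s.map_smul, H.smul_smul_smul hσK]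
  let c : ι → Module.End k ((K →₀ Λ) × P) := fun i =>
    LinearMap.prod
      (Module.toModuleEnd k (S := Λ) (K →₀ Λ) (a i) ∘ₗ LinearMap.fst k _ _ +
        δ i ∘ₗ LinearMap.snd k _ _)
      (Module.toModuleEnd k (S := Λ) P (a i) ∘ₗ LinearMap.snd k _ _)
  have hc : ∀ i y, c i y = (a i • y.1 + δ i y.2, a i • y.2) := fun i y => rfl
  obtain ⟨Φ, hΦ, hΦa⟩ := H.exists_action ((K →₀ Λ) × P) c fun i y => by
    rw [hc, hc, Prod.smul_mk, Prod.smul_fst, Prod.smul_snd, smul_add, H.smul_smul_smul hσE,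
      H.smul_smul_smul hσ, hδ, hδ, smul_smul, smul_smul, H.mul_self_left, H.mul_self_right]
  -- `V` is the product with the twisted action. It is kept opaque so that this action is not
  -- confused with the componentwise one.
  obtain ⟨V, _, _, fst, snd, mk, hmk, hV⟩ : ∃ (V : Type x) (_ : AddCommGroup V)
      (_ : Module Λ V) (fst : V →+ (K →₀ Λ)) (snd : V →+ P)
      (mk : (K →₀ Λ) → P → V), (∀ z y, snd (mk z y) = y) ∧
      ∀ (l : Λ) (y : V), (fst (l • y), snd (l • y)) = Φ l (fst y, snd y) := by
    let _ : Module Λ ((K →₀ Λ) × P) := Module.compHom _ Φ.toRingHom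
    exact ⟨(K →₀ Λ) × P, inferInstance, inferInstance, AddMonoidHom.fst _ _,
      AddMonoidHom.snd _ _, fun z y => (z, y), fun _ _ => rfl, fun _ _ => rfl⟩
  have hVσ : ∀ γ y, fst (σ γ • y) = γ • fst y ∧ snd (σ γ • y) = γ • snd y := fun γ y => by
    have := hV (σ γ) y
    rw [hΦ] at this
    exact ⟨congrArg Prod.fst this, congrArg Prod.snd this⟩
  have hVa : ∀ i y, fst (a i • y) = a i • fst y + δ i (snd y) ∧
      snd (a i • y) = a i • snd y := fun i y => by
    have := hV (a i) y
    rw [hΦa, hc] at this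
    exact ⟨congrArg Prod.fst this, congrArg Prod.snd this⟩
  let sndl : V →ₗ[Λ] P := { snd with
    map_smul' := H.map_smul_of_map_smul snd (fun γ y => by rw [(hVσ γ y).2, hσ])
      (fun i y => (hVa i y).2) }
  obtain ⟨t, ht⟩ := Module.projective_lifting_property sndl LinearMap.id
    (fun y => ⟨mk 0 y, hmk 0 y⟩)
  replace ht : ∀ y, snd (t y) = y := fun y => LinearMap.congr_fun ht y
  -- Although `fst` is not `Λ`-linear, its composite with `q` is, because the twist `δ` has values
  -- in the kernel of `q`.
  let qf : V →ₗ[Λ] K := { (q : (K →₀ Λ) →+ K).comp fst with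
    map_smul' := H.map_smul_of_map_smul ((q : (K →₀ Λ) →+ K).comp fst)
      (fun γ y => by
        change q (fst _) = _ • q (fst y)
        rw [(hVσ γ y).1, ← hσE, map_smul])
      (fun i y => by
        change q (fst _) = _ • q (fst y)
        rw [(hVa i y).1, map_add, hqδ, add_zero, map_smul]) }
  obtain ⟨h', hh'⟩ := Module.projective_lifting_property q (qf ∘ₗ t) hq
  replace hh' : ∀ y, q (h' y) = q (fst (t y)) := fun y => LinearMap.congr_fun hh' y
  -- The first component of `t` has defect `δ`, which cancels the defect of `s` along `g`. The sum
  -- is `Λ`-linear, but `q` maps it to the identity plus `q ∘ fst ∘ t ∘ g`. Subtracting `h' ∘ₗ g`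
  -- removes this error term.
  let sec : K →+ (K →₀ Λ) := s.toAddMonoidHom + fst.comp (t ∘ₗ g).toAddMonoidHom
  have hsec : ∀ y, sec y = s y + fst (t (g y)) := fun y => rfl
  let secl : K →ₗ[Λ] (K →₀ Λ) := { sec with
    map_smul' := H.map_smul_of_map_smul sec
      (fun γ y => by
        rw [hsec, hsec, g.map_smul, t.map_smul, (hVσ γ _).1, hσK, s.map_smul, hσE, smul_add])
      (fun i y => by
        rw [hsec, hsec, g.map_smul, t.map_smul, (hVa i _).1, ht, hδg, hd, smul_add]
        abel) }
  refine ⟨secl - h' ∘ₗ g, LinearMap.ext fun y => ?_⟩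
  change q (sec y - h' (g y)) = y
  rw [hsec, map_sub, map_add, hs, hh', add_sub_cancel_right]

/-- The family `c` defines a self-extension of `P` in which `a i` sends `(z, y)` to `(c i y, 0)`. A
`Λ`-linear splitting `t` gives `c i y = fst (a i • t y) = fst (t (a i • y)) = 0`. -/
theorem eq_zero_of_projective (H : IsFreeExtension σ e f a)
    (hσ : ∀ (γ : Γ) (y : P), σ γ • y = γ • y) (ha : ∀ i (y : P), a i • y = 0)
    [Module.Projective Λ P] (c : ι → Module.End k P) (hc : ∀ i y, e i • c i (f i • y) = c i y) :
    c = 0 := by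
  let c' : ι → Module.End k (P × P) := fun i =>
    LinearMap.prod (c i ∘ₗ LinearMap.snd k _ _) 0
  have hc' : ∀ i y, c' i y = (c i y.2, 0) := fun i y => rfl
  obtain ⟨Φ, hΦ, hΦa⟩ := H.exists_action (P × P) c' fun i y => by
    rw [hc', hc', Prod.smul_mk, Prod.smul_snd, smul_zero, hc]
  obtain ⟨V, _, _, fst, snd, mk, hmk, hV⟩ : ∃ (V : Type x) (_ : AddCommGroup V)
      (_ : Module Λ V) (fst : V →+ P) (snd : V →+ P)
      (mk : P → P → V), (∀ z y, snd (mk z y) = y) ∧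
      ∀ (l : Λ) (y : V), (fst (l • y), snd (l • y)) = Φ l (fst y, snd y) := by
    let _ : Module Λ (P × P) := Module.compHom _ Φ.toRingHom
    exact ⟨P × P, inferInstance, inferInstance, AddMonoidHom.fst _ _,
      AddMonoidHom.snd _ _, fun z y => (z, y), fun _ _ => rfl, fun _ _ => rfl⟩
  have hVa : ∀ i y, fst (a i • y) = c i (snd y) ∧ snd (a i • y) = 0 := fun i y => by
    have := hV (a i) y
    rw [hΦa, hc'] at this
    exact ⟨congrArg Prod.fst this, congrArg Prod.snd this⟩
  let sndl : V →ₗ[Λ] P := { snd with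
    map_smul' := H.map_smul_of_map_smul snd
      (fun γ y => by
        have := hV (σ γ) y
        rw [hΦ] at this
        rw [hσ]
        exact congrArg Prod.snd this)
      (fun i y => by rw [(hVa i y).2, ha]) }
  obtain ⟨t, ht⟩ := Module.projective_lifting_property sndl LinearMap.id
    (fun y => ⟨mk 0 y, hmk 0 y⟩)
  replace ht : ∀ y, snd (t y) = y := fun y => LinearMap.congr_fun ht y
  funext i
  ext y
  have := (hVa i (t y)).1
  rw [ht, ← map_smul, ha, map_zero, map_zero] at this
  exact this.symm

end

end IsFreeExtension

/-! ### Projective dimension under restriction of scalars -/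

instance ModuleCat.restrictScalars_preservesFiniteLimits {R S : Type x} [Ring R] [Ring S]
    (f : R →+* S) :
    Limits.PreservesFiniteLimits (ModuleCat.restrictScalars.{x} f) := by
  have : Limits.PreservesFiniteLimits
      (ModuleCat.restrictScalars.{x} f ⋙ forget₂ (ModuleCat.{x} R) AddCommGrpCat.{x}) :=
    inferInstanceAs (Limits.PreservesFiniteLimits (forget₂ (ModuleCat.{x} S) AddCommGrpCat.{x}))
  exact Limits.preservesFiniteLimits_of_reflects_of_preserves _
    (forget₂ (ModuleCat.{x} R) AddCommGrpCat.{x})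

namespace IsFreeExtension

variable {k : Type w} {Λ Γ : Type x} [Field k] [Ring Λ] [Ring Γ] [Algebra k Λ]
  [Algebra k Γ] {σ : Γ →ₐ[k] Λ} {ι : Type v} {e f : ι → Γ} {a : ι → Λ}

lemma projective_restrictScalars_obj (H : IsFreeExtension σ e f a) (M : ModuleCat.{x} Λ)
    [Module.Projective Λ M] :
    Module.Projective Γ ((ModuleCat.restrictScalars σ.toRingHom).obj M) := by
  let N := (ModuleCat.restrictScalars σ.toRingHom).obj M
  let _ : Module Λ N := inferInstanceAs (Module Λ M)
  let _ : Module k N := Module.compHom N (algebraMap k Γ)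
  have : IsScalarTower k Γ N := IsScalarTower.of_algebraMap_smul fun _ _ => rfl
  have : Module.Projective Λ N := inferInstanceAs (Module.Projective Λ M)
  exact H.projective_restrict (P := N) fun _ _ => rfl

lemma projective_of_mono (H : IsFreeExtension σ e f a) {M P : ModuleCat.{x} Λ} (g : M ⟶ P) [Mono g]
    [Module.Projective Λ P]
    [hM : Module.Projective Γ ((ModuleCat.restrictScalars σ.toRingHom).obj M)] :
    Module.Projective Λ M := by
  let _ : Module Γ M := Module.compHom M σ.toRingHom
  let _ : Module Γ P := Module.compHom P σ.toRingHom
  let _ : Module k M := Module.compHom M (algebraMap k Γ)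
  let _ : Module k P := Module.compHom P (algebraMap k Γ)
  have : IsScalarTower k Γ M := IsScalarTower.of_algebraMap_smul fun _ _ => rfl
  have : IsScalarTower k Γ P := IsScalarTower.of_algebraMap_smul fun _ _ => rfl
  have : Module.Projective Γ M := hM
  exact H.projective_of_injective (P := P) (K := M) (fun _ _ => rfl) (fun _ _ => rfl) g.hom
    ((ModuleCat.mono_iff_injective g).1 inferInstance)

/-- One sequence computes syzygies over both rings, since restriction is exact and keeps the middle
term projective. Both dimension-shifting inductions run on it. -/
lemma exists_projective_cover (H : IsFreeExtension σ e f a) (M : ModuleCat.{x} Λ) :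
    ∃ (P K : ModuleCat.{x} Λ) (i : K ⟶ P) (g : P ⟶ M) (w : i ≫ g = 0),
      (ShortComplex.mk i g w).ShortExact ∧
      ((ShortComplex.mk i g w).map (ModuleCat.restrictScalars σ.toRingHom)).ShortExact ∧
      Projective P ∧ Projective ((ModuleCat.restrictScalars σ.toRingHom).obj P) := by
  rcases ModuleCat.enoughProjectives.1 M with ⟨⟨P, g⟩⟩
  have hT : (ShortComplex.mk (Limits.kernel.ι g) g (Limits.kernel.condition g)).ShortExact :=
    { exact := ShortComplex.exact_kernel g }
  refine ⟨P, _, _, g, _, hT, hT.map_of_exact _, inferInstance, ?_⟩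
  have : Module.Projective Λ P := (IsProjective.iff_projective _).2 inferInstance
  rw [← IsProjective.iff_projective]
  exact H.projective_restrictScalars_obj P

lemma hasProjectiveDimensionLE_restrictScalars (H : IsFreeExtension σ e f a) (n : ℕ)
    (M : ModuleCat.{x} Λ) (hM : HasProjectiveDimensionLE M n) :
    HasProjectiveDimensionLE ((ModuleCat.restrictScalars σ.toRingHom).obj M) n := by
  induction n generalizing M with
  | zero =>
    rw [← projective_iff_hasProjectiveDimensionLE_zero, ← IsProjective.iff_projective] at hM ⊢
    exact H.projective_restrictScalars_obj M
  | succ n ih =>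
    obtain ⟨P, K, i, g, w, hT, hS, hP, hP'⟩ := H.exists_projective_cover M
    have h1 := (hT.hasProjectiveDimensionLT_X₃_iff n hP).mp hM
    exact (hS.hasProjectiveDimensionLT_X₃_iff n hP').mpr (ih _ h1)

/-- The bound has to be at least 1: only a syzygy, being a submodule of a projective `Λ`-module,
inherits projectivity from `Γ`. -/
lemma hasProjectiveDimensionLE_of_restrictScalars (H : IsFreeExtension σ e f a) (n : ℕ)
    (M : ModuleCat.{x} Λ)
    (hM : HasProjectiveDimensionLE ((ModuleCat.restrictScalars σ.toRingHom).obj M) (n + 1)) :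
    HasProjectiveDimensionLE M (n + 1) := by
  induction n generalizing M with
  | zero =>
    obtain ⟨P, K, i, g, w, hT, hS, hP, hP'⟩ := H.exists_projective_cover M
    have h1 := (hS.hasProjectiveDimensionLT_X₃_iff 0 hP').mp hM
    refine (hT.hasProjectiveDimensionLT_X₃_iff 0 hP).mpr ?_
    rw [zero_add, ← projective_iff_hasProjectiveDimensionLT_one,
      ← IsProjective.iff_projective] at h1 ⊢
    have : Module.Projective Λ P := (IsProjective.iff_projective _).2 hP
    have : Mono i := hT.mono_f
    exact H.projective_of_mono (hM := h1) i
  | succ n ih =>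
    obtain ⟨P, K, i, g, w, hT, hS, hP, hP'⟩ := H.exists_projective_cover M
    have h1 := (hS.hasProjectiveDimensionLT_X₃_iff (n + 1) hP').mp hM
    exact (hT.hasProjectiveDimensionLT_X₃_iff (n + 1) hP).mpr (ih _ h1)

lemma projectiveDimension_restrictScalars_le (H : IsFreeExtension σ e f a) (M : ModuleCat.{x} Λ) :
    projectiveDimension ((ModuleCat.restrictScalars σ.toRingHom).obj M) ≤
      projectiveDimension M := by
  refine le_of_forall_ge fun N => ?_
  induction N with
  | bot =>
    rw [le_bot_iff, le_bot_iff, projectiveDimension_eq_bot_iff, projectiveDimension_eq_bot_iff]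
    exact fun h => (ModuleCat.restrictScalars σ.toRingHom).map_isZero h
  | coe N =>
    induction N with
    | top => exact fun _ => le_top
    | coe n =>
      intro h
      exact (projectiveDimension_le_iff _ n).2
        (H.hasProjectiveDimensionLE_restrictScalars n M ((projectiveDimension_le_iff M n).1 h))

lemma projectiveDimension_le_max (H : IsFreeExtension σ e f a) (M : ModuleCat.{x} Λ) :
    projectiveDimension M ≤
      max 1 (projectiveDimension ((ModuleCat.restrictScalars σ.toRingHom).obj M)) := by
  refine le_of_forall_ge fun N => ?_
  induction N with
  | bot => exact fun h => absurd (le_trans (le_max_left _ _) h) (by decide)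
  | coe N =>
    induction N with
    | top => exact fun _ => le_top
    | coe n =>
      intro h
      obtain ⟨h1, h2⟩ := max_le_iff.1 h
      have h1' : 1 ≤ n := by exact_mod_cast h1
      obtain ⟨n, rfl⟩ := Nat.exists_eq_add_of_le' h1'
      exact (projectiveDimension_le_iff M (n + 1)).2
        (H.hasProjectiveDimensionLE_of_restrictScalars n M ((projectiveDimension_le_iff _ _).1 h2))

/-! ### Inflation along the retraction, and comparison of suprema -/

section Retraction

variable {π : Λ →ₐ[k] Γ}

lemma projectiveDimension_restrictScalars_restrictScalars (hπ : ∀ γ, π (σ γ) = γ)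
    (N : ModuleCat.{x} Γ) :
    projectiveDimension ((ModuleCat.restrictScalars σ.toRingHom).obj
      ((ModuleCat.restrictScalars π.toRingHom).obj N)) = projectiveDimension N := by
  have h : RingHom.id Γ = π.toRingHom.comp σ.toRingHom := RingHom.ext fun γ => (hπ γ).symm
  exact projectiveDimension_eq_of_iso
    ((ModuleCat.restrictScalarsComp'App _ _ _ h N).symm ≪≫ ModuleCat.restrictScalarsId'App _ rfl N)

lemma projectiveDimension_self (H : IsFreeExtension σ e f a) (hπ : ∀ γ, π (σ γ) = γ)
    (ha : ∀ i, π (a i) = 0) (he : ∀ i, e i ≠ 0) (hf : ∀ i, f i ≠ 0) [Nonempty ι] :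
    projectiveDimension ((ModuleCat.restrictScalars π.toRingHom).obj (ModuleCat.of Γ Γ)) = 1 := by
  set X := (ModuleCat.restrictScalars π.toRingHom).obj (ModuleCat.of Γ Γ) with hX
  refine le_antisymm ?_ ?_
  · refine (H.projectiveDimension_le_max X).trans (max_le le_rfl ?_)
    rw [hX, projectiveDimension_restrictScalars_restrictScalars hπ]
    have : Projective (ModuleCat.of Γ Γ) := (IsProjective.iff_projective Γ).1 inferInstance
    exact (projectiveDimension_le_iff _ 1).2 inferInstance
  · refine (projectiveDimension_ge_iff X 1).2 fun h => ?_
    rw [← projective_iff_hasProjectiveDimensionLT_one, ← IsProjective.iff_projective] at h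
    let _ : Module Λ Γ := Module.compHom Γ π.toRingHom
    have hs : ∀ (l : Λ) (γ : Γ), l • γ = π l * γ := fun _ _ => rfl
    have : Module.Projective Λ Γ := h
    let i : ι := Classical.arbitrary ι
    obtain ⟨l, hl⟩ : ∃ l : Module.Dual k Γ, l (f i) ≠ 0 := by
      by_contra! hl
      exact hf i ((Module.forall_dual_apply_eq_zero_iff k _).1 hl)
    -- If the inflated module were projective, every compatible family would vanish. This rank-one
    -- family sends `1` to `l (f i) • e i`, which is nonzero at the chosen index.
    let c : ι → Module.End k Γ := fun i =>
      (LinearMap.toSpanSingleton k Γ (e i)) ∘ₗ l ∘ₗ LinearMap.mulLeft k (f i)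
    have hc : ∀ i y, c i y = l (f i * y) • e i := fun i y => rfl
    have h0 := H.eq_zero_of_projective (P := Γ) (fun γ y => by rw [hs, hπ, smul_eq_mul])
      (fun i y => by rw [hs, ha, zero_mul]) c (fun i y => by
        rw [hc, hc, smul_eq_mul, smul_eq_mul, ← mul_assoc, H.mul_self_right, mul_smul_comm,
          H.mul_self_left])
    have h1 : c i 1 = 0 := by rw [h0]; rfl
    rw [hc, mul_one, smul_eq_zero] at h1
    exact h1.elim hl (he i)

/-- The classes `S` and `T` allow one argument for all three dimensions: it only needs them to be
exchanged by restriction and inflation, and `Γ` itself to belong to `T`. -/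
lemma iSup_projectiveDimension (H : IsFreeExtension σ e f a) (hπ : ∀ γ, π (σ γ) = γ)
    (ha : ∀ i, π (a i) = 0) (he : ∀ i, e i ≠ 0) (hf : ∀ i, f i ≠ 0)
    (S : ModuleCat.{x} Λ → Prop) (T : ModuleCat.{x} Γ → Prop)
    (hST : ∀ M, S M → T ((ModuleCat.restrictScalars σ.toRingHom).obj M))
    (hTS : ∀ N, T N → S ((ModuleCat.restrictScalars π.toRingHom).obj N))
    (hT : T (ModuleCat.of Γ Γ)) :
    (0 < (⨆ N : {N // T N}, projectiveDimension N.1) →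
      (⨆ M : {M // S M}, projectiveDimension M.1) = ⨆ N : {N // T N}, projectiveDimension N.1) ∧
    ((⨆ N : {N // T N}, projectiveDimension N.1) = 0 → Nonempty ι →
      (⨆ M : {M // S M}, projectiveDimension M.1) = 1) := by
  have hle : (⨆ M : {M // S M}, projectiveDimension M.1) ≤
      max 1 (⨆ N : {N // T N}, projectiveDimension N.1) :=
    iSup_le fun M => (H.projectiveDimension_le_max M.1).trans (max_le_max le_rfl
      (le_iSup (fun N : {N // T N} => projectiveDimension N.1) ⟨_, hST M.1 M.2⟩))
  refine ⟨fun h0 => le_antisymm (hle.trans (max_le ?_ le_rfl)) ?_, fun h0 _ => le_antisymm ?_ ?_⟩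
  · generalize (⨆ N : {N // T N}, projectiveDimension N.1) = d at h0
    induction d with
    | bot => exact absurd h0 (by simp)
    | coe d =>
      have h0' : 0 < d := by exact_mod_cast h0
      exact_mod_cast Order.one_le_iff_pos.2 h0'
  · refine iSup_le fun N => ?_
    refine le_trans ?_ (le_iSup (fun M : {M // S M} => projectiveDimension M.1) ⟨_, hTS N.1 N.2⟩)
    rw [← projectiveDimension_restrictScalars_restrictScalars hπ N.1]
    exact H.projectiveDimension_restrictScalars_le _
  · rw [h0] at hle
    exact hle.trans (max_le le_rfl zero_le_one)
  · rw [← H.projectiveDimension_self hπ ha he hf]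
    exact le_iSup (fun M : {M // S M} => projectiveDimension M.1) ⟨_, hTS _ hT⟩

/-- Finite generation passes through finite dimension over `k`. -/
lemma finite_restrictScalars_obj [Module.Finite k Λ] (M : ModuleCat.{x} Λ) [Module.Finite Λ M] :
    Module.Finite Γ ((ModuleCat.restrictScalars σ.toRingHom).obj M) := by
  let _ : Module Γ M := Module.compHom M σ.toRingHom
  let _ : Module k M := Module.compHom M (algebraMap k Λ)
  have : IsScalarTower k Λ M := IsScalarTower.of_algebraMap_smul fun _ _ => rfl
  have : IsScalarTower k Γ M := IsScalarTower.of_algebraMap_smul fun r y =>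
    congrArg (· • y) (σ.commutes r)
  have : Module.Finite k M := Module.Finite.trans Λ M
  exact (Module.Finite.of_restrictScalars_finite k Γ M : Module.Finite Γ M)

lemma finite_restrictScalars_obj_of_surjective (hπ : Function.Surjective π) (N : ModuleCat.{x} Γ)
    [hN : Module.Finite Γ N] :
    Module.Finite Λ ((ModuleCat.restrictScalars π.toRingHom).obj N) := by
  let _ : Module Λ N := Module.compHom N π.toRingHom
  obtain ⟨s, hs⟩ := hN.fg_top
  refine (⟨⟨s, ?_⟩⟩ : Module.Finite Λ N)
  refine Submodule.eq_top_iff'.2 fun y => ?_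
  have hy : y ∈ Submodule.span Γ (s : Set N) := by rw [hs]; trivial
  induction hy using Submodule.span_induction with
  | mem y hy => exact Submodule.subset_span hy
  | zero => exact zero_mem _
  | add y z _ _ hy hz => exact add_mem hy hz
  | smul γ y _ hy =>
    obtain ⟨l, rfl⟩ := hπ γ
    exact Submodule.smul_mem _ l hy

/-- Homological dimensions of an algebra obtained by freely adjoining elements. -/
theorem homologicalDimensions (H : IsFreeExtension σ e f a) (hπ : ∀ γ, π (σ γ) = γ)
    (ha : ∀ i, π (a i) = 0) (he : ∀ i, e i ≠ 0) (hf : ∀ i, f i ≠ 0) [Module.Finite k Λ] :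
    ((0 < littleFinitisticDim Γ → littleFinitisticDim Λ = littleFinitisticDim Γ) ∧
      (littleFinitisticDim Γ = 0 → Nonempty ι → littleFinitisticDim Λ = 1)) ∧
    ((0 < bigFinitisticDim Γ → bigFinitisticDim Λ = bigFinitisticDim Γ) ∧
      (bigFinitisticDim Γ = 0 → Nonempty ι → bigFinitisticDim Λ = 1)) ∧
    ((0 < globalDim Γ → globalDim Λ = globalDim Γ) ∧
      (globalDim Γ = 0 → Nonempty ι → globalDim Λ = 1)) := by
  have hres : ∀ M : ModuleCat.{x} Λ, projectiveDimension M ≠ ⊤ →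
      projectiveDimension ((ModuleCat.restrictScalars σ.toRingHom).obj M) ≠ ⊤ := fun M hM =>
    ne_top_of_le_ne_top hM (H.projectiveDimension_restrictScalars_le M)
  have hinfl : ∀ N : ModuleCat.{x} Γ, projectiveDimension N ≠ ⊤ →
      projectiveDimension ((ModuleCat.restrictScalars π.toRingHom).obj N) ≠ ⊤ := fun N hN => by
    refine ne_top_of_le_ne_top ?_ (H.projectiveDimension_le_max _)
    rw [projectiveDimension_restrictScalars_restrictScalars hπ]
    exact ne_of_lt (max_lt (by decide) (lt_top_iff_ne_top.2 hN))
  have hself : projectiveDimension (ModuleCat.of Γ Γ) ≠ ⊤ := by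
    have : Projective (ModuleCat.of Γ Γ) := (IsProjective.iff_projective Γ).1 inferInstance
    exact (projectiveDimension_ne_top_iff _).2 ⟨0, inferInstance⟩
  have hglob : ∀ (R : Type x) [Ring R],
      globalDim R = ⨆ M : {M : ModuleCat.{x} R // True}, projectiveDimension M.1 := fun R _ =>
    (Equiv.subtypeUnivEquiv fun _ => trivial).symm.iSup_congr fun _ => rfl
  refine ⟨?_, ?_, ?_⟩
  · exact H.iSup_projectiveDimension hπ ha he hf _ _
      (fun M ⟨h, h'⟩ => ⟨finite_restrictScalars_obj M, hres M h'⟩)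
      (fun N ⟨h, h'⟩ => ⟨finite_restrictScalars_obj_of_surjective (fun γ => ⟨σ γ, hπ γ⟩) N,
        hinfl N h'⟩) ⟨inferInstanceAs (Module.Finite Γ Γ), hself⟩
  · exact H.iSup_projectiveDimension hπ ha he hf _ _ hres hinfl hself
  · rw [hglob, hglob]
    exact H.iSup_projectiveDimension hπ ha he hf _ _ (fun _ _ => trivial) (fun _ _ => trivial)
      trivial

end Retraction

end IsFreeExtension

/-! ### Homomorphisms out of quotients by two-sided ideals -/

namespace TwoSidedIdeal

variable {k : Type*} [CommSemiring k] {R S : Type*} [Ring R] [Algebra k R] [Ring S] [Algebra k S]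
  (I : TwoSidedIdeal R)

lemma mkₐ_eq_zero_iff (z : R) : I.ringCon.mkₐ k z = 0 ↔ z ∈ I := by
  rw [I.mem_iff]
  exact I.ringCon.eq

lemma exists_algHom_lift (f : R →ₐ[k] S) (h : ∀ z ∈ I, f z = 0) :
    ∃ g : I.ringCon.Quotient →ₐ[k] S, ∀ z, g (I.ringCon.mkₐ k z) = f z :=
  ⟨I.ringCon.liftₐ f fun y z hyz => by
    have := h _ ((I.rel_iff y z).1 hyz)
    rw [map_sub, sub_eq_zero] at this
    exact this, fun _ => rfl⟩

end TwoSidedIdeal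

/-! ### The bound quiver algebra as a free extension -/

namespace BoundQuiver

open PathAlgebra

variable {k : Type w} [Field k] {Q : Type u} [Quiver.{v} Q] [Fintype Q]

/-- The projection from the path algebra onto the bound quiver algebra. -/
noncomputable abbrev toQuiverAlg (I : TwoSidedIdeal (PathAlgebra k Q)) :
    PathAlgebra k Q →ₐ[k] QuiverAlg I :=
  I.ringCon.mkₐ k

/-- The projection of the bound quiver algebra which kills the arrows in `A`. -/
noncomputable abbrev toArrowQuot (I : TwoSidedIdeal (PathAlgebra k Q))
    (A : Set (Quiver.Total Q)) : QuiverAlg I →ₐ[k] ArrowQuot I A :=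
  (arrowIdeal I A).ringCon.mkₐ k

variable {I : TwoSidedIdeal (PathAlgebra k Q)} {A : Set (Quiver.Total Q)}

lemma toArrowQuot_arrow {α : Quiver.Total Q} (hα : α ∈ A) :
    toArrowQuot I A (toQuiverAlg I (ofPath k (arrowPath α))) = 0 :=
  ((arrowIdeal I A).mkₐ_eq_zero_iff (k := k) _).2 (TwoSidedIdeal.subset_span ⟨α, hα, rfl⟩)

/-- A trivial path has length 0, whereas paths occurring in `I` have length at least 2. This makes
the idempotents at the ends of adjoined arrows nonzero. -/
lemma toQuiverAlg_trivial_ne_zero (hI : IsAdmissible I) (a : Q) :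
    toQuiverAlg I (ofPath k (QPath.trivial a)) ≠ 0 := by
  intro h
  have h2 := hI.1 _ ((I.mkₐ_eq_zero_iff (k := k) _).1 h) (QPath.trivial a)
    ((occurs_iff _ _).2 (by rw [coeff_ofPath, if_pos rfl]; exact one_ne_zero))
  exact absurd h2 (by simp [QPath.length, QPath.trivial])

/-- Sending the arrows of `A` to zero and fixing all other arrows and the vertices still kills `I`,
by redundancy, so this map factors through both quotients. -/
lemma exists_section (hfin : A.Finite) (hA : ∀ α ∈ A, IsRedundant I α) :
    ∃ σ : ArrowQuot I A →ₐ[k] QuiverAlg I,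
      (∀ a, σ (toArrowQuot I A (toQuiverAlg I (ofPath k (QPath.trivial a)))) =
        toQuiverAlg I (ofPath k (QPath.trivial a))) ∧
      (∀ α ∉ A, σ (toArrowQuot I A (toQuiverAlg I (ofPath k (arrowPath α)))) =
        toQuiverAlg I (ofPath k (arrowPath α))) ∧
      ∀ γ, toArrowQuot I A (σ γ) = γ := by
  obtain ⟨ρ, -, hv, hn, h0⟩ := exists_algHom_update (toQuiverAlg I) A 0 (by simp)
  obtain ⟨τ, hτ⟩ := I.exists_algHom_lift ρ
    (algHom_eq_zero_of_redundant hfin hA hv hn fun z hz => (I.mkₐ_eq_zero_iff (k := k) z).2 hz)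
  obtain ⟨σ, hσ⟩ := (arrowIdeal I A).exists_algHom_lift τ (by
    have : arrowIdeal I A ≤ TwoSidedIdeal.ker τ := by
      rw [arrowIdeal, TwoSidedIdeal.span_le]
      rintro _ ⟨α, hα, rfl⟩
      exact (TwoSidedIdeal.mem_ker _).2 ((hτ _).trans (h0 ⟨α, hα⟩))
    exact fun z hz => (TwoSidedIdeal.mem_ker _).1 (this hz))
  have hστ : ∀ z, σ (toArrowQuot I A (toQuiverAlg I z)) = ρ z := fun z => (hσ _).trans (hτ z)
  have key : (toArrowQuot I A).comp ρ = (toArrowQuot I A).comp (toQuiverAlg I) := by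
    refine algHom_ext (fun a => congrArg (toArrowQuot I A) (hv a)) fun α => ?_
    by_cases hα : α ∈ A
    · rw [AlgHom.comp_apply, AlgHom.comp_apply, toArrowQuot_arrow hα, h0 ⟨α, hα⟩, Pi.zero_apply,
        map_zero]
    · exact congrArg (toArrowQuot I A) (hn α hα)
  refine ⟨σ, fun a => (hστ _).trans (hv a), fun α hα => (hστ _).trans (hn α hα), fun γ => ?_⟩
  obtain ⟨l, rfl⟩ := RingCon.mkₐ_surjective (α := k) _ γ
  obtain ⟨z, rfl⟩ := RingCon.mkₐ_surjective (α := k) _ l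
  exact (congrArg _ (hστ z)).trans (DFunLike.congr_fun key z)

lemma isFreeExtension (hfin : A.Finite) (hA : ∀ α ∈ A, IsRedundant I α)
    {σ : ArrowQuot I A →ₐ[k] QuiverAlg I}
    (hv : ∀ a, σ (toArrowQuot I A (toQuiverAlg I (ofPath k (QPath.trivial a)))) =
        toQuiverAlg I (ofPath k (QPath.trivial a)))
    (hn : ∀ α ∉ A, σ (toArrowQuot I A (toQuiverAlg I (ofPath k (arrowPath α)))) =
        toQuiverAlg I (ofPath k (arrowPath α))) :
    IsFreeExtension σ
      (fun α : A => toArrowQuot I A (toQuiverAlg I (ofPath k (QPath.trivial α.1.left))))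
      (fun α : A => toArrowQuot I A (toQuiverAlg I (ofPath k (QPath.trivial α.1.right))))
      (fun α : A => toQuiverAlg I (ofPath k (arrowPath α.1))) where
  mul_self_left α := by rw [← map_mul, ← map_mul, trivial_mul_self]
  mul_self_right α := by rw [← map_mul, ← map_mul, trivial_mul_self]
  mul_mul α := by
    rw [hv, hv, ← map_mul, ← map_mul, trivial_mul_arrow, arrow_mul_trivial]
  adjoin := by
    refine Algebra.eq_top_iff.2 fun l => ?_
    obtain ⟨z, rfl⟩ := RingCon.mkₐ_surjective (α := k) _ l
    induction z using PathAlgebra.induction with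
    | h0 => rw [map_zero]; exact zero_mem _
    | hadd y z hy hz => rw [map_add]; exact add_mem hy hz
    | hp c p =>
      rw [map_smul]
      refine Subalgebra.smul_mem _ ?_ c
      obtain ⟨a, b, p⟩ := p
      induction p with
      | nil => exact Algebra.subset_adjoin (Or.inl ⟨_, hv a⟩)
      | @cons b c p f ih =>
        rw [ofPath_cons, map_mul]
        refine mul_mem ih (Algebra.subset_adjoin ?_)
        by_cases hα : (⟨b, c, f⟩ : Quiver.Total Q) ∈ A
        · exact Or.inr ⟨⟨_, hα⟩, rfl⟩
        · exact Or.inl ⟨_, hn _ hα⟩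
  exists_action V _ _ _ _ c hc := by
    let Ψ₀ : ArrowQuot I A →ₐ[k] Module.End k V := Algebra.lsmul k k V
    let Ψ := (Ψ₀.comp (toArrowQuot I A)).comp (toQuiverAlg I)
    -- The given action `Ψ` kills `I`. Changing its values on redundant arrows to `c` preserves
    -- this, so the new action descends to `Λ`.
    obtain ⟨Φ₀, -, hv', hn', hc'⟩ := exists_algHom_update Ψ A c
      (fun α => LinearMap.ext fun y => hc α y)
    obtain ⟨Φ, hΦ⟩ := I.exists_algHom_lift Φ₀
      (algHom_eq_zero_of_redundant hfin hA hv' hn' fun z hz => by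
        have : toQuiverAlg I z = 0 := (I.mkₐ_eq_zero_iff (k := k) z).2 hz
        rw [AlgHom.comp_apply, this, map_zero])
    have key : (Φ.comp σ).comp ((toArrowQuot I A).comp (toQuiverAlg I)) = Ψ := by
      refine algHom_ext (fun a => ?_) fun α => ?_
      · exact (congrArg Φ (hv a)).trans ((hΦ _).trans (hv' a))
      · by_cases hα : α ∈ A
        · change Φ (σ (toArrowQuot I A (toQuiverAlg I _))) =
            Ψ₀ (toArrowQuot I A (toQuiverAlg I _))
          rw [toArrowQuot_arrow hα, map_zero, map_zero, map_zero]
        · exact (congrArg Φ (hn α hα)).trans ((hΦ _).trans (hn' α hα))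
    refine ⟨Φ, fun γ y => ?_, fun α => (hΦ _).trans (hc' α)⟩
    obtain ⟨l, rfl⟩ := RingCon.mkₐ_surjective (α := k) _ γ
    obtain ⟨z, rfl⟩ := RingCon.mkₐ_surjective (α := k) _ l
    exact LinearMap.congr_fun (DFunLike.congr_fun key z) y

lemma toQuiverAlg_eq_zero_of_le_length {N : ℕ}
    (hN : ∀ p : QPath Q, p.length = N → ofPath k p ∈ I) (p : QPath Q) (hp : N ≤ p.length) :
    toQuiverAlg I (ofPath k p) = 0 := by
  obtain ⟨a, b, p⟩ := p
  induction p with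
  | nil => exact (I.mkₐ_eq_zero_iff (k := k) _).2 (hN _ (le_antisymm (Nat.zero_le _) hp))
  | cons p f ih =>
    rcases hp.eq_or_lt with h | h
    · exact (I.mkₐ_eq_zero_iff (k := k) _).2 (hN _ h.symm)
    · rw [ofPath_cons, map_mul, ih (Nat.lt_succ_iff.1 h), zero_mul]

/-- A path of length `n` lies in `V * W ^ n`, where `V` and `W` are spanned by the finitely many
vertices and arrows. Paths of length at least `N` vanish, so finitely many such products span. -/
lemma finite_quiverAlg [∀ a b : Q, Finite (a ⟶ b)] (hI : IsAdmissible I) :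
    Module.Finite k (QuiverAlg I) := by
  obtain ⟨-, N, -, hN⟩ := hI
  let V : Submodule k (QuiverAlg I) :=
    Submodule.span k (Set.range fun a : Q => toQuiverAlg I (ofPath k (QPath.trivial a)))
  let W : Submodule k (QuiverAlg I) :=
    Submodule.span k (Set.range fun α : Quiver.Total Q => toQuiverAlg I (ofPath k (arrowPath α)))
  have hV : V.FG := Submodule.fg_span (Set.finite_range _)
  have hW : W.FG := Submodule.fg_span (Set.finite_range _)
  have hmem : ∀ p : QPath Q, toQuiverAlg I (ofPath k p) ∈ V * W ^ p.length := by
    rintro ⟨a, b, p⟩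
    induction p with
    | nil =>
      change _ ∈ V * W ^ 0
      rw [pow_zero, mul_one]
      exact Submodule.subset_span ⟨a, rfl⟩
    | @cons b c p f ih =>
      change _ ∈ V * W ^ (p.length + 1)
      rw [pow_succ, ← mul_assoc, ofPath_cons, map_mul]
      exact Submodule.mul_mem_mul ih (Submodule.subset_span ⟨⟨b, c, f⟩, rfl⟩)
  have htop : (⊤ : Submodule k (QuiverAlg I)) = ⨆ n : Fin N, V * W ^ n.1 := by
    refine (Submodule.eq_top_iff'.2 fun l => ?_).symm
    obtain ⟨z, rfl⟩ := RingCon.mkₐ_surjective (α := k) _ l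
    induction z using PathAlgebra.induction with
    | h0 => rw [map_zero]; exact zero_mem _
    | hadd y z hy hz => rw [map_add]; exact add_mem hy hz
    | hp c p =>
      rw [map_smul]
      refine Submodule.smul_mem _ c ?_
      rcases lt_or_ge p.length N with h | h
      · exact Submodule.mem_iSup_of_mem ⟨p.length, h⟩ (hmem p)
      · have := toQuiverAlg_eq_zero_of_le_length hN p h
        rw [this]
        exact zero_mem _
  refine ⟨?_⟩
  rw [htop]
  exact Submodule.fg_iSup _ fun n => hV.mul (hW.pow n.1)

end BoundQuiver

theorem mainTheorem6 {k : Type w} [Field k] {Q : Type u} [Quiver.{v} Q] [Fintype Q]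
    [∀ a b : Q, Finite (a ⟶ b)]
    (I : TwoSidedIdeal (BoundQuiver.PathAlgebra k Q)) (hI : BoundQuiver.IsAdmissible I)
    (A : Set (Quiver.Total Q)) (hA : ∀ α ∈ A, BoundQuiver.IsRedundant I α) :
    ((0 < littleFinitisticDim (BoundQuiver.ArrowQuot I A) →
        littleFinitisticDim (BoundQuiver.QuiverAlg I) =
          littleFinitisticDim (BoundQuiver.ArrowQuot I A)) ∧
      (littleFinitisticDim (BoundQuiver.ArrowQuot I A) = 0 → A.Nonempty →
        littleFinitisticDim (BoundQuiver.QuiverAlg I) = 1)) ∧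
    ((0 < bigFinitisticDim (BoundQuiver.ArrowQuot I A) →
        bigFinitisticDim (BoundQuiver.QuiverAlg I) =
          bigFinitisticDim (BoundQuiver.ArrowQuot I A)) ∧
      (bigFinitisticDim (BoundQuiver.ArrowQuot I A) = 0 → A.Nonempty →
        bigFinitisticDim (BoundQuiver.QuiverAlg I) = 1)) ∧
    ((0 < globalDim (BoundQuiver.ArrowQuot I A) →
        globalDim (BoundQuiver.QuiverAlg I) = globalDim (BoundQuiver.ArrowQuot I A)) ∧
      (globalDim (BoundQuiver.ArrowQuot I A) = 0 → A.Nonempty →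
        globalDim (BoundQuiver.QuiverAlg I) = 1)) := by
  obtain ⟨σ, hv, hn, hπ⟩ := BoundQuiver.exists_section A.toFinite hA
  have := BoundQuiver.finite_quiverAlg hI
  have hne : ∀ a : Q, BoundQuiver.toArrowQuot I A (BoundQuiver.toQuiverAlg I
      (BoundQuiver.PathAlgebra.ofPath k (BoundQuiver.QPath.trivial a))) ≠ 0 := fun a h =>
    BoundQuiver.toQuiverAlg_trivial_ne_zero hI a (by rw [← hv a, h, map_zero])
  simpa only [Set.nonempty_coe_sort] using
    (BoundQuiver.isFreeExtension A.toFinite hA hv hn).homologicalDimensions hπ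
      (fun α => BoundQuiver.toArrowQuot_arrow α.2) (fun α => hne _) (fun α => hne _)
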